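/- **Setting.** Consider processes $P_1,\dots,P_n$ of which at most $t$ are Byzantine (faulty), where $t>0$ and $n>3t$; the others are correct. They communicate over reliable authenticated point-to-point links in the partially synchronous model: each execution has a time $\mathrm{GST}$, unknown to the processes, such that a message sent at time $u$ by a correct process to a correct process is received by time $\max(\mathrm{GST},u)+\delta$, where $\delta>0$ is known to the processes. Local clocks may drift arbitrarily before $\mathrm{GST}$ (without running backwards) and do not drift thereafter; local computation takes no time, and only finitely many steps are taken in finite time. Let $\mathsf{hash}$ be a collision-resistant hash function (no two distinct vectors occurring in an execution have the same hash), and assume an ideal $(n-t,n)$-threshold signature scheme: faulty processes cannot forge signatures of correct processes, and valid partial signatures of the same hash value by $n-t$ distinct processes can be combined into a threshold signature for it; a threshold signature is valid only if at least $n-t$ processes have signed. **Vector-dissemination algorithm** (process $P_i$). Each correct process may be asked, at most once, to disseminate a vector of exactly $n-t$ values. 1. Upon $\mathsf{disseminate}(\mathit{vec})$: set $H_i=\mathsf{hash}(\mathit{vec})$ and slow-broadcast $\mathit{vec}$, i.e. for $j=1,\dots,n$ in turn, send $\mathit{vec}$ to $P_j$ and then wait $\delta\cdot n^{i-1}$ time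 on the local clock, while other messages continue to be handled. 2. Upon receiving the first slow-broadcast vector $\mathit{vec}'$ from $P_j$: cache $\mathit{vec}'$ and send to $P_j$ a message $\langle\textsc{stored},\mathsf{hash}(\mathit{vec}'),\sigma\rangle$, where $\sigma$ is $P_i$'s partial signature of $\mathsf{hash}(\mathit{vec}')$. 3. Once $\langle\textsc{stored},H_i,\cdot\rangle$ messages with valid partial signatures have been received from $n-t$ distinct processes: combine these signatures into a threshold signature $\mathit{tsig}$ and send $\langle\textsc{confirm},H_i,\mathit{tsig}\rangle$ to all processes (once). 4. Upon receiving $\langle\textsc{confirm},H',\mathit{tsig}'\rangle$ with $\mathit{tsig}'$ a valid $(n-t)$-threshold signature for $H'$: send this message to all processes, acquire $(H',\mathit{tsig}')$, and stop participating (sending and processing messages), also in the slow broadcast. The communication complexity of an execution is the number of words sent by correct processes at and after $\mathrm{GST}$, where one word carries one value, hash or signature (so a slow-broadcast message has $n-t$ words, and every other message has $2$). **Theorem.** There is a universal constant $C$ such that for all $n>3t>0$, all $\delta>0$, all sets of values and hash values, and every execution of the algorithm: - *Complexity.* If no correct process starts the dissemination of its vector after time $\mathrm{GST}+\delta$, then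 the communication complexity of the execution is at most $C\,n^2$. - *Termination.* If at least one correct process disseminates a vector (in particular, if all of them do), then every correct process eventually acquires a hash-signature pair. - *Integrity.* If a correct process acquires $(H,\mathit{tsig})$, then $\mathit{tsig}$ is a valid $(n-t)$-threshold signature for $H$. - *Redundancy.* Whenever a correct process has cached (combined, or received and acquired) a threshold signature for a hash value $H$, at least $t+1$ correct processes have cached one and the same vector $\mathit{vec}$ with $\mathsf{hash}(\mathit{vec})=H$. -/

import Mathlib

open scoped ENNReal

namespace VectorDissemination

/-! ### Vectors, threshold signatures, messages

Processes are the elements of `Fin n`; the process usually called `P_{i+1}` is `i : Fin n`. -/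

/-- A vector of exactly `n - t` values. -/
abbrev Vec (n t : ℕ) (V : Type*) := Fin (n - t) → V

/-- The (ideal) partial signature of the hash value `msg` under the private key of `signer`. -/
structure PSig (n : ℕ) (Hash : Type*) where
  signer : Fin n
  msg : Hash

/-- The result of combining the partial signatures of `msg` produced by `signers`. -/
structure TSig (n : ℕ) (Hash : Type*) where
  msg : Hash
  signers : Finset (Fin n)

/-- `sig` is a valid partial signature of `h` by process `j`. -/
def PSig.Valid {n : ℕ} {Hash : Type*} (sig : PSig n Hash) (j : Fin n) (h : Hash) : Prop :=
  sig.signer = j ∧ sig.msg = h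

/-- `verify_sig(h, sig) = true`: `sig` is a valid `(n - t)`-threshold signature for `h`. -/
def TSig.Valid {n : ℕ} {Hash : Type*} (t : ℕ) (sig : TSig n Hash) (h : Hash) : Prop :=
  sig.msg = h ∧ n - t ≤ sig.signers.card

open scoped Classical in
/-- Combine those partial signatures of the given set that sign `h`. -/
noncomputable def combine {n : ℕ} {Hash : Type*} (h : Hash) (sigs : Finset (PSig n Hash)) :
    TSig n Hash :=
  ⟨h, (sigs.filter (fun p => p.msg = h)).image PSig.signer⟩

/-- The three kinds of messages of the algorithm. -/
inductive Msg (n t : ℕ) (V Hash : Type*)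
  | slow (vec : Vec n t V)
  | stored (h : Hash) (sig : PSig n Hash)
  | confirm (h : Hash) (sig : TSig n Hash)

/-- The size of a message in words, where one word carries one value, hash or signature. -/
def Msg.words {n t : ℕ} {V Hash : Type*} : Msg n t V Hash → ℕ
  | .slow _ => n - t
  | .stored _ _ => 2
  | .confirm _ _ => 2

/-! ### The algorithm: one deterministic state machine per process -/

/-- A running slow broadcast: `vec` has been sent to the processes of index `< next`; the current
waiting step is over once the local clock shows at least `deadline`. -/
structure SlowBroadcast (n t : ℕ) (V : Type*) where
  vec : Vec n t V
  next : ℕ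
  deadline : ℝ

/-- The local state of a process. -/
structure LocalState (n t : ℕ) (V Hash : Type*) where
  /-- hash of the vector that the process disseminates (`none` before it starts) -/
  ownHash : Option Hash
  /-- cached vectors -/
  vectors : Hash → Option (Vec n t V)
  /-- processes that have disseminated a vector to this process -/
  disseminated : Finset (Fin n)
  /-- partial signatures received for `ownHash` -/
  acks : Finset (PSig n Hash)
  /-- the threshold signature for `ownHash` that the process has combined, if any -/
  formed : Option (TSig n Hash)
  /-- the slow broadcast of the process, if started -/
  slow : Option (SlowBroadcast n t V)
  /-- the acquired hash-signature pair, if any; the process participates as long as it is `none` -/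
  acquired : Option (Hash × TSig n Hash)

/-- The initial local state. -/
def LocalState.initial (n t : ℕ) (V Hash : Type*) : LocalState n t V Hash where
  ownHash := none
  vectors := fun _ => none
  disseminated := ∅
  acks := ∅
  formed := none
  slow := none
  acquired := none

/-- What can trigger a computational step: a request, a received message (`src` is its sender, as
links are authenticated), or the end of a waiting step. -/
inductive Input (n t : ℕ) (V Hash : Type*)
  | disseminate (vec : Vec n t V)
  | receive (src : Fin n) (m : Msg n t V Hash)
  | wake

section Algorithm

variable {n t : ℕ} {V Hash : Type*}

/-- A new local state, and the messages sent, each with its destination. -/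
abbrev StepResult (n t : ℕ) (V Hash : Type*) :=
  LocalState n t V Hash × List (Fin n × Msg n t V Hash)

/-- Best-effort broadcast: send `m` to every process. -/
def broadcast (m : Msg n t V Hash) : List (Fin n × Msg n t V Hash) :=
  (List.finRange n).map (fun j => (j, m))

/-- Slow broadcast at process `i` whose local clock shows `now`: send `vec` to the process of index
`k` and start waiting for `δ * n ^ i` (the first process waits `δ`, the second `δ * n`, ...). -/
noncomputable def slowSend (δ : ℝ) (i : Fin n) (now : ℝ) (vec : Vec n t V) (k : ℕ)
    (s : LocalState n t V Hash) : StepResult n t V Hash :=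
  if hk : k < n then
    ({ s with slow := some ⟨vec, k + 1, now + δ * (n : ℝ) ^ (i : ℕ)⟩ }, [(⟨k, hk⟩, Msg.slow vec)])
  else (s, [])

/-- Upon `disseminate(vec)`. -/
noncomputable def onDisseminate (δ : ℝ) (hash : Vec n t V → Hash) (i : Fin n) (now : ℝ)
    (vec : Vec n t V) (s : LocalState n t V Hash) : StepResult n t V Hash :=
  slowSend δ i now vec 0 { s with ownHash := some (hash vec) }

/-- Upon the end of a waiting step of the slow broadcast. -/
noncomputable def onWake (δ : ℝ) (i : Fin n) (now : ℝ) (s : LocalState n t V Hash) :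
    StepResult n t V Hash :=
  match s.slow with
  | some b => if b.deadline ≤ now then slowSend δ i now b.vec b.next s else (s, [])
  | none => (s, [])

open scoped Classical in
/-- Upon delivery of the slow-broadcast vector `vec` from `j`: cache and acknowledge it, if it is
the first one from `j`. -/
noncomputable def onSlow (hash : Vec n t V → Hash) (i j : Fin n) (vec : Vec n t V)
    (s : LocalState n t V Hash) : StepResult n t V Hash :=
  if j ∈ s.disseminated then (s, [])
  else
    ({ s with
        disseminated := insert j s.disseminated
        vectors := Function.update s.vectors (hash vec) (some vec) },
      [(j, Msg.stored (hash vec) ⟨i, hash vec⟩)])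

open scoped Classical in
/-- Upon reception of an acknowledgement: as soon as valid partial signatures of `ownHash` have been
received from `n - t` distinct processes, combine them and broadcast the result (once). -/
noncomputable def onStored (j : Fin n) (h : Hash) (sig : PSig n Hash)
    (s : LocalState n t V Hash) : StepResult n t V Hash :=
  if s.ownHash = some h ∧ sig.Valid j h ∧ s.formed = none then
    if n - t ≤ (insert sig s.acks).card then
      ({ s with
          acks := insert sig s.acks
          formed := some (combine h (insert sig s.acks)) },
        broadcast (Msg.confirm h (combine h (insert sig s.acks))))
    else ({ s with acks := insert sig s.acks }, [])
  else (s, [])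

open scoped Classical in
/-- Upon reception of a threshold signature: if it is valid, rebroadcast it, acquire the pair, and
stop participating. -/
noncomputable def onConfirm (h : Hash) (sig : TSig n Hash) (s : LocalState n t V Hash) :
    StepResult n t V Hash :=
  if sig.Valid t h then
    ({ s with acquired := some (h, sig) }, broadcast (Msg.confirm h sig))
  else (s, [])

open scoped Classical in
/-- One computational step of process `i` whose local clock shows `now`. A process that has stopped
participating neither sends nor processes anything. -/
noncomputable def step (δ : ℝ) (hash : Vec n t V → Hash) (i : Fin n) (now : ℝ) :
    Input n t V Hash → LocalState n t V Hash → StepResult n t V Hash := fun inp s =>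
  if s.acquired ≠ none then (s, [])
  else
    match inp with
    | .disseminate vec => onDisseminate δ hash i now vec s
    | .wake => onWake δ i now s
    | .receive j (.slow vec) => onSlow hash i j vec s
    | .receive j (.stored h sig) => onStored j h sig s
    | .receive _ (.confirm h sig) => onConfirm h sig s

end Algorithm

/-! ### Executions in the partially synchronous Byzantine model -/

/-- A run: the set of correct processes, the global stabilization time, the local clocks (as
functions of real time), and a sequence of computational steps of correct processes with the real
times at which they happen (`none` is a moment at which no correct process takes a step). Faulty
processes are represented by the messages that correct processes receive from them. -/
structure Run (n t : ℕ) (V Hash : Type*) where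
  correct : Finset (Fin n)
  GST : ℝ
  clock : Fin n → ℝ → ℝ
  time : ℕ → ℝ
  event : ℕ → Option (Fin n × Input n t V Hash)

namespace Run

variable {n t : ℕ} {V Hash : Type*}

open scoped Classical in
/-- The local states just before the `k`-th event. -/
noncomputable def state (r : Run n t V Hash) (δ : ℝ) (hash : Vec n t V → Hash) :
    ℕ → Fin n → LocalState n t V Hash
  | 0 => fun _ => LocalState.initial n t V Hash
  | k + 1 =>
    match r.event k with
    | none => r.state δ hash k
    | some (i, inp) =>
      Function.update (r.state δ hash k) i
        (step δ hash i (r.clock i (r.time k)) inp (r.state δ hash k i)).1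

/-- The messages that the process taking the `k`-th step sends in it. -/
noncomputable def outbox (r : Run n t V Hash) (δ : ℝ) (hash : Vec n t V → Hash) (k : ℕ) :
    List (Fin n × Msg n t V Hash) :=
  match r.event k with
  | none => []
  | some (i, inp) => (step δ hash i (r.clock i (r.time k)) inp (r.state δ hash k i)).2

/-- At the `k`-th event, process `i` sends `m` to process `j`. -/
def Sends (r : Run n t V Hash) (δ : ℝ) (hash : Vec n t V → Hash) (k : ℕ) (i j : Fin n)
    (m : Msg n t V Hash) : Prop :=
  (∃ inp, r.event k = some (i, inp)) ∧ (j, m) ∈ r.outbox δ hash k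

/-- Before the `k`-th event, the correct process `i` has (partially) signed `h`. -/
def HasSigned (r : Run n t V Hash) (δ : ℝ) (hash : Vec n t V → Hash) (k : ℕ) (i : Fin n)
    (h : Hash) : Prop :=
  ∃ k' < k, ∃ j, r.Sends δ hash k' i j (Msg.stored h ⟨i, h⟩)

/-- The messages that faulty processes are able to send before the `k`-th event: anything that
does not contain a forged signature of a correct process. -/
def Forgeable (r : Run n t V Hash) (δ : ℝ) (hash : Vec n t V → Hash) (k : ℕ) :
    Msg n t V Hash → Prop
  | .slow _ => True
  | .stored _ sig => sig.signer ∈ r.correct → r.HasSigned δ hash k sig.signer sig.msg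
  | .confirm _ sig => ∀ i ∈ sig.signers, i ∈ r.correct → r.HasSigned δ hash k i sig.msg

/-- `vec` occurs in the run (as an input or in a received message). -/
def Occurs (r : Run n t V Hash) (vec : Vec n t V) : Prop :=
  ∃ k i, r.event k = some (i, .disseminate vec) ∨
    ∃ j, r.event k = some (i, .receive j (.slow vec))

/-- Before the `k`-th event, process `i` is in a waiting step between two sending events of its
slow broadcast, which lasts until its local clock shows `d`. -/
def Waiting (r : Run n t V Hash) (δ : ℝ) (hash : Vec n t V → Hash) (k : ℕ) (i : Fin n)
    (d : ℝ) : Prop :=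
  (r.state δ hash k i).acquired = none ∧
    ∃ b, (r.state δ hash k i).slow = some b ∧ b.next < n ∧ b.deadline = d

/-- The run is an execution of the algorithm, with known delay bound `δ` and hash function `hash`,
among `n` processes at most `t` of which are faulty. -/
structure IsExecution (r : Run n t V Hash) (δ : ℝ) (hash : Vec n t V → Hash) : Prop where
  /-- at most `t` processes are faulty -/
  faulty_le : (r.correctᶜ).card ≤ t
  /-- the listed steps are those of correct processes -/
  event_correct : ∀ k i inp, r.event k = some (i, inp) → i ∈ r.correct
  /-- events are listed in the order of time -/
  time_mono : Monotone r.time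
  /-- only finitely many steps are taken in finite time -/
  time_unbounded : Filter.Tendsto r.time Filter.atTop Filter.atTop
  /-- local clocks never run backwards, but may drift arbitrarily before GST -/
  clock_mono : ∀ i, Monotone (r.clock i)
  /-- local clocks do not drift after GST -/
  clock_rate : ∀ i, ∀ u v : ℝ, r.GST ≤ u → u ≤ v → r.clock i v - r.clock i u = v - u
  /-- a correct process continues its slow broadcast as soon as its waiting step is over: when an
  event happens, no waiting step has ended strictly earlier -/
  prompt : ∀ k, ∀ i ∈ r.correct, ∀ d, r.Waiting δ hash k i d → ∀ u < r.time k, r.clock i u < d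
  /-- a correct process disseminates at most one vector -/
  disseminate_once : ∀ i k k' vec vec', r.event k = some (i, .disseminate vec) →
    r.event k' = some (i, .disseminate vec') → k = k'
  /-- authenticated links: a message received from a correct process was sent by it before -/
  authentic : ∀ k i j m, r.event k = some (i, .receive j m) → j ∈ r.correct →
    ∃ k' < k, r.Sends δ hash k' j i m
  /-- faulty processes cannot forge signatures of correct processes -/
  unforgeable : ∀ k i j m, r.event k = some (i, .receive j m) → j ∉ r.correct →
    r.Forgeable δ hash k m
  /-- reliable links with partial synchrony: a message sent at time `u` from a correct process to a
  correct process is received by time `max GST u + δ` -/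
  delivery : ∀ k i j m, r.Sends δ hash k i j m → j ∈ r.correct →
    ∃ k' > k, r.event k' = some (j, .receive i m) ∧ r.time k' ≤ max r.GST (r.time k) + δ
  /-- collision resistance: nobody comes up with two vectors that have the same hash -/
  collision_free : ∀ v w, r.Occurs v → r.Occurs w → hash v = hash w → v = w

/-! ### The claimed properties of an execution -/

/-- No correct process starts the dissemination of its vector after time `GST + δ`. (A request made
to a process that has already stopped participating starts nothing.) -/
def NoLateStart (r : Run n t V Hash) (δ : ℝ) (hash : Vec n t V → Hash) : Prop :=
  ∀ k, ∀ i ∈ r.correct, ∀ vec, r.event k = some (i, .disseminate vec) →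
    (r.state δ hash k i).acquired = none → r.time k ≤ r.GST + δ

open scoped Classical in
/-- The number of words sent by correct processes at and after GST. -/
noncomputable def commComplexity (r : Run n t V Hash) (δ : ℝ) (hash : Vec n t V → Hash) : ℝ≥0∞ :=
  ∑' k : ℕ, if r.GST ≤ r.time k
    then ((((r.outbox δ hash k).map (fun p => p.2.words)).sum : ℕ) : ℝ≥0∞) else 0

/-- Every correct process eventually acquires a hash-signature pair, provided that at least one
correct process disseminates a vector. -/
def Termination (r : Run n t V Hash) (δ : ℝ) (hash : Vec n t V → Hash) : Prop :=
  (∃ i ∈ r.correct, ∃ k vec, r.event k = some (i, .disseminate vec)) →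
    ∀ j ∈ r.correct, ∃ k h sig, (r.state δ hash k j).acquired = some (h, sig)

/-- Every pair acquired by a correct process passes signature verification. -/
def Integrity (r : Run n t V Hash) (δ : ℝ) (hash : Vec n t V → Hash) : Prop :=
  ∀ k, ∀ i ∈ r.correct, ∀ h sig, (r.state δ hash k i).acquired = some (h, sig) → sig.Valid t h

/-- Before the `k`-th event, process `i` has cached the threshold signature `sig` for `h`: it has
combined it itself, or received and acquired it. -/
def Caches (r : Run n t V Hash) (δ : ℝ) (hash : Vec n t V → Hash) (k : ℕ) (i : Fin n)
    (h : Hash) (sig : TSig n Hash) : Prop :=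
  ((r.state δ hash k i).ownHash = some h ∧ (r.state δ hash k i).formed = some sig) ∨
    (r.state δ hash k i).acquired = some (h, sig)

open scoped Classical in
/-- Whenever a correct process has cached a threshold signature for `h`, some vector with hash `h`
has been cached by at least `t + 1` correct processes. -/
def Redundancy (r : Run n t V Hash) (δ : ℝ) (hash : Vec n t V → Hash) : Prop :=
  ∀ k, ∀ i ∈ r.correct, ∀ h sig, r.Caches δ hash k i h sig →
    ∃ vec, hash vec = h ∧
      t + 1 ≤ (r.correct.filter (fun j => (r.state δ hash k j).vectors h = some vec)).card

end Run

end VectorDissemination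

/-! Write D_i = δ n^i for the waiting time of process `i`.

Safety rests on an invariant: no signature in circulation is forged
(`IsExecution.genuineSignatures`). A valid threshold signature therefore has at least n - 2t > t
correct signers. Each of them cached a vector with that hash when signing, and collision resistance
makes these vectors equal and protects the caches from being overwritten.

Liveness is `IsExecution.acquired_of_starts`: if a correct `j` starts by time B ≥ GST, every correct
process holds a pair after B + (n - 1) D_j + 3δ. Otherwise no valid confirmation was sent early
enough, so nobody had stopped; the slow broadcast of `j` is then completed within (n - 1) D_j, and
the deliveries of vector, acknowledgement and confirmation cost δ each.

For the complexity, a process sends at most 6n words outside its slow broadcast. Let `j` be the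
least index that starts. All correct processes stop by GST + (n - 1) D_j + 4δ. Process `j` sends at
most n slow messages, while a process i > j waits D_i ≥ n D_j after each of its own, so that at most
three fall at or after GST (`count_le_three`). The total is at most 9n · n + n² = 10n² words. -/

namespace VectorDissemination

variable {n t : ℕ} {V Hash : Type*}

/-! ### One step as a transition relation, and the combination of signatures. -/

open scoped Classical in
/-- The possible effects of one step: `Transition δ hash i now s inp s' out` says how process `i`
in state `s` reacts to `inp`. -/
inductive Transition (δ : ℝ) (hash : Vec n t V → Hash) (i : Fin n) (now : ℝ)
    (s : LocalState n t V Hash) :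
    Input n t V Hash → LocalState n t V Hash → List (Fin n × Msg n t V Hash) → Prop
  | idle (inp) : Transition δ hash i now s inp s []
  | start (vec) (k : Fin n) (hk : (k : ℕ) = 0) (ha : s.acquired = none) :
      Transition δ hash i now s (.disseminate vec)
        { s with ownHash := some (hash vec), slow := some ⟨vec, 1, now + δ * (n : ℝ) ^ (i : ℕ)⟩ }
        [(k, .slow vec)]
  | wake (b) (k : Fin n) (hk : (k : ℕ) = b.next) (ha : s.acquired = none) (hb : s.slow = some b)
      (hd : b.deadline ≤ now) :
      Transition δ hash i now s .wake
        { s with slow := some ⟨b.vec, b.next + 1, now + δ * (n : ℝ) ^ (i : ℕ)⟩ }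
        [(k, .slow b.vec)]
  | store (j vec) (ha : s.acquired = none) (hj : j ∉ s.disseminated) :
      Transition δ hash i now s (.receive j (.slow vec))
        { s with
          disseminated := insert j s.disseminated
          vectors := Function.update s.vectors (hash vec) (some vec) }
        [(j, .stored (hash vec) ⟨i, hash vec⟩)]
  | ack (j h sig) (ha : s.acquired = none) (ho : s.ownHash = some h) (hv : sig.Valid j h)
      (hf : s.formed = none) (hc : (insert sig s.acks).card < n - t) :
      Transition δ hash i now s (.receive j (.stored h sig))
        { s with acks := insert sig s.acks } []
  | form (j h sig) (ha : s.acquired = none) (ho : s.ownHash = some h) (hv : sig.Valid j h)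
      (hf : s.formed = none) (hc : n - t ≤ (insert sig s.acks).card) :
      Transition δ hash i now s (.receive j (.stored h sig))
        { s with
          acks := insert sig s.acks
          formed := some (combine h (insert sig s.acks)) }
        (broadcast (.confirm h (combine h (insert sig s.acks))))
  | acquire (j h sig) (ha : s.acquired = none) (hv : sig.Valid t h) :
      Transition δ hash i now s (.receive j (.confirm h sig))
        { s with acquired := some (h, sig) } (broadcast (.confirm h sig))

/-- Invariants are proved by cases on `Transition` instead of unfolding `step`. Since `idle` carries
no condition, the relation only bounds what a step can do; wherever a reaction must take place,
`step` itself is unfolded. -/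
theorem transition_step (δ : ℝ) (hash : Vec n t V → Hash) (i : Fin n) (now : ℝ)
    (inp : Input n t V Hash) (s : LocalState n t V Hash) :
    Transition δ hash i now s inp (step δ hash i now inp s).1 (step δ hash i now inp s).2 := by
  classical
  unfold step
  split_ifs with ha
  · exact .idle _
  · have ha : s.acquired = none := not_not.mp ha
    match inp with
    | .disseminate vec =>
      have hn : 0 < n := i.pos
      simp only [onDisseminate, slowSend, hn, dif_pos, zero_add]
      exact .start vec ⟨0, hn⟩ rfl ha
    | .wake =>
      simp only [onWake]
      split
      · rename_i b hb
        split_ifs with hd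
        · unfold slowSend
          split_ifs with hk
          · exact .wake b ⟨_, hk⟩ rfl ha hb hd
          · exact .idle _
        · exact .idle _
      · exact .idle _
    | .receive j (.slow vec) =>
      simp only [onSlow]
      split_ifs with hj
      · exact .idle _
      · exact .store j vec ha hj
    | .receive j (.stored h sig) =>
      simp only [onStored]
      split_ifs with hs hc
      · exact .form j h sig ha hs.1 hs.2.1 hs.2.2 (by convert hc)
      · exact .ack j h sig ha hs.1 hs.2.1 hs.2.2 (by convert not_le.mp hc)
      · exact .idle _
    | .receive j (.confirm h sig) =>
      simp only [onConfirm]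
      split_ifs with hv
      · exact .acquire j h sig ha hv
      · exact .idle _

theorem mem_broadcast {m m' : Msg n t V Hash} {j : Fin n} :
    (j, m') ∈ broadcast m ↔ m' = m := by
  simp [broadcast, eq_comm]

/-- A partial signature of a fixed hash is determined by its signer, so counting signatures is
counting distinct processes. -/
theorem card_signers_combine {h : Hash} {sigs : Finset (PSig n Hash)}
    (hs : ∀ p ∈ sigs, p.msg = h) : (combine h sigs).signers.card = sigs.card := by
  classical
  unfold combine
  rw [Finset.filter_true_of_mem hs, Finset.card_image_of_injOn]
  rintro ⟨a, x⟩ ha ⟨b, y⟩ hb hab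
  have h1 := hs _ ha
  have h2 := hs _ hb
  simp_all

theorem exists_of_mem_signers_combine {h : Hash} {sigs : Finset (PSig n Hash)} {l : Fin n}
    (hl : l ∈ (combine h sigs).signers) : (⟨l, h⟩ : PSig n Hash) ∈ sigs := by
  classical
  simp only [combine, Finset.mem_image, Finset.mem_filter] at hl
  obtain ⟨⟨a, x⟩, ⟨h1, h2⟩, h3⟩ := hl
  simp_all

/-! ### Induction along a run. -/

namespace Run

variable {r : Run n t V Hash} {δ : ℝ} {hash : Vec n t V → Hash} {k k' : ℕ} {i j : Fin n}

theorem state_succ_of_event {inp : Input n t V Hash} (he : r.event k = some (i, inp)) :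
    r.state δ hash (k + 1) i =
      (step δ hash i (r.clock i (r.time k)) inp (r.state δ hash k i)).1 := by
  simp [state, he]

theorem outbox_of_event {inp : Input n t V Hash} (he : r.event k = some (i, inp)) :
    r.outbox δ hash k = (step δ hash i (r.clock i (r.time k)) inp (r.state δ hash k i)).2 := by
  simp [outbox, he]

theorem state_succ_of_ne (he : ∀ inp, r.event k ≠ some (i, inp)) :
    r.state δ hash (k + 1) i = r.state δ hash k i := by
  rcases hl : r.event k with _ | ⟨l, inp⟩
  · simp [state, hl]
  · have : i ≠ l := by
      rintro rfl
      exact he _ hl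
    simp [state, hl, this]

theorem transition {inp : Input n t V Hash} (he : r.event k = some (i, inp)) :
    Transition δ hash i (r.clock i (r.time k)) (r.state δ hash k i) inp
      (r.state δ hash (k + 1) i) (r.outbox δ hash k) := by
  rw [state_succ_of_event he, outbox_of_event he]
  exact transition_step ..

/-- Induction over the states that process `i` goes through from the `k₀`-th event on. -/
theorem state_induction_from (i : Fin n) (k₀ : ℕ) {P : ℕ → LocalState n t V Hash → Prop}
    (zero : P k₀ (r.state δ hash k₀ i))
    (keep : ∀ k s, k₀ ≤ k → P k s → P (k + 1) s)
    (next : ∀ k inp s' out, k₀ ≤ k → r.event k = some (i, inp) → P k (r.state δ hash k i) →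
      r.outbox δ hash k = out →
      Transition δ hash i (r.clock i (r.time k)) (r.state δ hash k i) inp s' out → P (k + 1) s')
    (k : ℕ) (hk : k₀ ≤ k) : P k (r.state δ hash k i) := by
  induction k, hk using Nat.le_induction with
  | base => exact zero
  | succ k hk ih =>
    by_cases he : ∃ inp, r.event k = some (i, inp)
    · obtain ⟨inp, he⟩ := he
      exact next k inp _ _ hk he ih rfl (transition he)
    · rw [state_succ_of_ne (not_exists.mp he)]
      exact keep _ _ hk ih

/-- Induction over the states that process `i` goes through. -/
theorem state_induction (i : Fin n) {P : ℕ → LocalState n t V Hash → Prop}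
    (zero : P 0 (.initial n t V Hash))
    (keep : ∀ k s, P k s → P (k + 1) s)
    (next : ∀ k inp s' out, r.event k = some (i, inp) → P k (r.state δ hash k i) →
      r.outbox δ hash k = out →
      Transition δ hash i (r.clock i (r.time k)) (r.state δ hash k i) inp s' out → P (k + 1) s')
    (k : ℕ) : P k (r.state δ hash k i) :=
  state_induction_from i 0 zero (fun k s _ => keep k s) (fun k inp s' out _ => next k inp s' out)
    k k.zero_le

/-! ### Monotonicity of the local states -/

/-- Every transition except `idle` requires `acquired = none`, so a process that has acquired is
frozen. -/
theorem state_eq_of_acquired (hk : k ≤ k') (ha : (r.state δ hash k i).acquired ≠ none) :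
    r.state δ hash k' i = r.state δ hash k i := by
  refine state_induction_from (P := fun _ s => s = r.state δ hash k i) i k rfl
    (fun _ _ _ h => h) (fun l inp s' out _ he ih _ ht => ?_) k' hk
  rw [ih] at ht
  cases ht with
  | idle => rfl
  | _ => contradiction

theorem acquired_mono (hk : k ≤ k') (ha : (r.state δ hash k i).acquired ≠ none) :
    (r.state δ hash k' i).acquired ≠ none := by
  rwa [state_eq_of_acquired hk ha]

theorem acquired_eq_none_of_le (hk : k ≤ k') (ha : (r.state δ hash k' i).acquired = none) :
    (r.state δ hash k i).acquired = none := by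
  by_contra h
  exact acquired_mono hk h ha

theorem formed_mono (hk : k ≤ k') (hf : (r.state δ hash k i).formed ≠ none) :
    (r.state δ hash k' i).formed ≠ none := by
  refine state_induction_from (P := fun _ s => s.formed ≠ none) i k hf
    (fun _ _ _ h => h) (fun l inp s' out _ he ih _ ht => ?_) k' hk
  cases ht <;> simp_all

theorem acks_mono (hk : k ≤ k') : (r.state δ hash k i).acks ⊆ (r.state δ hash k' i).acks := by
  classical
  refine state_induction_from (P := fun _ s => _ ⊆ s.acks) i k subset_rfl
    (fun _ _ _ h => h) (fun l inp s' out _ he ih _ ht => ?_) k' hk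
  cases ht with
  | ack => exact ih.trans (by convert Finset.subset_insert _ _)
  | form => exact ih.trans (by convert Finset.subset_insert _ _)
  | _ => exact ih

/-! ### The start of a dissemination -/

/-- At the `k`-th event, process `i` starts to disseminate `vec`. -/
def Starts (r : Run n t V Hash) (δ : ℝ) (hash : Vec n t V → Hash) (k : ℕ) (i : Fin n)
    (vec : Vec n t V) : Prop :=
  r.event k = some (i, .disseminate vec) ∧ (r.state δ hash k i).acquired = none

/-- Wake-ups never change the vector, so a running slow broadcast traces back to the request that
opened it. -/
theorem starts_of_slow (k : ℕ) {b : SlowBroadcast n t V}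
    (hb : (r.state δ hash k i).slow = some b) : ∃ k' < k, r.Starts δ hash k' i b.vec := by
  revert b
  refine state_induction (P := fun k s => ∀ {b}, s.slow = some b →
    ∃ k' < k, r.Starts δ hash k' i b.vec) i (by simp [LocalState.initial])
    (fun k s h b hb => ?_) (fun l inp s' out he ih _ ht b hb => ?_) k
  · obtain ⟨k', hk', h'⟩ := h hb
    exact ⟨k', hk'.trans (Nat.lt_succ_self _), h'⟩
  · have key : ∀ {b}, (r.state δ hash l i).slow = some b →
        ∃ k' < l + 1, r.Starts δ hash k' i b.vec := fun h =>
      let ⟨k', hk', h'⟩ := ih h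
      ⟨k', hk'.trans (Nat.lt_succ_self _), h'⟩
    cases ht with
    | start vec m hm ha =>
      obtain rfl := Option.some.inj hb
      exact ⟨l, Nat.lt_succ_self _, he, ha⟩
    | wake b' m hm ha hb' hd =>
      obtain rfl := Option.some.inj hb
      have := key hb'
      exact this
    | _ => exact key hb

theorem starts_of_ownHash (k : ℕ) {h : Hash}
    (hh : (r.state δ hash k i).ownHash = some h) :
    ∃ k' < k, ∃ vec, r.Starts δ hash k' i vec ∧ hash vec = h := by
  revert h
  refine state_induction (P := fun k s => ∀ {h}, s.ownHash = some h →
    ∃ k' < k, ∃ vec, r.Starts δ hash k' i vec ∧ hash vec = h) i (by simp [LocalState.initial])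
    (fun k s h b hb => ?_) (fun l inp s' out he ih _ ht b hb => ?_) k
  · obtain ⟨k', hk', h'⟩ := h hb
    exact ⟨k', hk'.trans (Nat.lt_succ_self _), h'⟩
  · have key : ∀ {b}, (r.state δ hash l i).ownHash = some b →
        ∃ k' < l + 1, ∃ vec, r.Starts δ hash k' i vec ∧ hash vec = b := fun h =>
      let ⟨k', hk', h'⟩ := ih h
      ⟨k', hk'.trans (Nat.lt_succ_self _), h'⟩
    cases ht with
    | start vec m hm ha =>
      exact ⟨l, Nat.lt_succ_self _, vec, ⟨he, ha⟩, Option.some.inj hb⟩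
    | _ => exact key hb

theorem starts_of_sends_slow {vec : Vec n t V} (hs : r.Sends δ hash k i j (.slow vec)) :
    ∃ k' ≤ k, r.Starts δ hash k' i vec := by
  obtain ⟨⟨inp, he⟩, hm⟩ := hs
  have ht := transition (δ := δ) (hash := hash) he
  generalize r.outbox δ hash k = out at hm ht
  generalize r.state δ hash (k + 1) i = s' at ht
  cases ht with
  | idle => simp at hm
  | start vec' m hk ha =>
    simp only [List.mem_singleton, Prod.mk.injEq, Msg.slow.injEq] at hm
    exact ⟨k, le_rfl, hm.2 ▸ he, ha⟩
  | wake b m hk ha hb hd =>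
    simp only [List.mem_singleton, Prod.mk.injEq, Msg.slow.injEq] at hm
    obtain ⟨k', hk', h'⟩ := starts_of_slow k hb
    exact ⟨k', hk'.le, hm.2 ▸ h'⟩
  | store => simp at hm
  | ack => simp at hm
  | form => simp [mem_broadcast] at hm
  | acquire => simp [mem_broadcast] at hm

end Run

namespace Run

variable {r : Run n t V Hash} {δ : ℝ} {hash : Vec n t V → Hash} {k k' : ℕ} {i j : Fin n}

theorem IsExecution.starts_unique (hr : r.IsExecution δ hash) {v w : Vec n t V}
    (hv : r.Starts δ hash k i v) (hw : r.Starts δ hash k' i w) : k = k' ∧ v = w := by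
  obtain rfl := hr.disseminate_once _ _ _ _ _ hv.1 hw.1
  have := hv.1.symm.trans hw.1
  simp_all

/-- A trace of a dissemination before its request would reveal a second, earlier request. -/
theorem IsExecution.not_started (hr : r.IsExecution δ hash) {v : Vec n t V}
    (hv : r.event k = some (i, .disseminate v)) (hk : k' ≤ k) :
    (r.state δ hash k' i).slow = none ∧ (r.state δ hash k' i).ownHash = none := by
  constructor
  · by_contra h
    obtain ⟨b, hb⟩ := Option.ne_none_iff_exists'.mp h
    obtain ⟨l, hl, hs⟩ := starts_of_slow k' hb
    have := hr.disseminate_once _ _ _ _ _ hv hs.1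
    omega
  · by_contra h
    obtain ⟨b, hb⟩ := Option.ne_none_iff_exists'.mp h
    obtain ⟨l, hl, w, hs, -⟩ := starts_of_ownHash k' hb
    have := hr.disseminate_once _ _ _ _ _ hv hs.1
    omega

theorem IsExecution.ownHash_of_starts (hr : r.IsExecution δ hash) {v : Vec n t V}
    (hv : r.Starts δ hash k i v) (hk : k < k') :
    (r.state δ hash k' i).ownHash = some (hash v) := by
  refine state_induction_from (P := fun _ s => s.ownHash = some (hash v)) i (k + 1) ?_
    (fun _ _ _ h => h) (fun l inp s' out hl he ih _ ht => ?_) k' hk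
  · rw [state_succ_of_event hv.1]
    simp [step, hv.2, onDisseminate, slowSend, i.pos]
  · cases ht with
    | start w m hm ha =>
      have := hr.disseminate_once _ _ _ _ _ he hv.1
      omega
    | _ => exact ih

/-! ### Signatures -/

theorem HasSigned.mono {h : Hash} (hs : r.HasSigned δ hash k i h) (hk : k ≤ k') :
    r.HasSigned δ hash k' i h :=
  let ⟨l, hl, hs⟩ := hs
  ⟨l, hl.trans_le hk, hs⟩

theorem Forgeable.mono {m : Msg n t V Hash} (hm : r.Forgeable δ hash k m) (hk : k ≤ k') :
    r.Forgeable δ hash k' m := by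
  match m with
  | .slow _ => trivial
  | .stored _ sig => exact fun h => (hm h).mono hk
  | .confirm _ sig => exact fun i hi h => (hm i hi h).mono hk

/-- The signatures that a process holds in state `s` are genuine before the `k`-th event. -/
structure GenuineSignatures (r : Run n t V Hash) (δ : ℝ) (hash : Vec n t V → Hash) (k : ℕ)
    (s : LocalState n t V Hash) : Prop where
  acks_msg : ∀ p ∈ s.acks, s.ownHash = some p.msg
  acks_signed : ∀ p ∈ s.acks, p.signer ∈ r.correct → r.HasSigned δ hash k p.signer p.msg
  -- Needed for liveness: enough acknowledgements force a combination.
  acks_card : s.formed = none → s.acks.card < n - t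
  formed_valid : ∀ sig, s.formed = some sig → s.ownHash = some sig.msg ∧ sig.Valid t sig.msg
  formed_signed : ∀ sig, s.formed = some sig → ∀ l ∈ sig.signers, l ∈ r.correct →
    r.HasSigned δ hash k l sig.msg
  acquired_valid : ∀ h sig, s.acquired = some (h, sig) → sig.Valid t h
  acquired_signed : ∀ h sig, s.acquired = some (h, sig) → ∀ l ∈ sig.signers, l ∈ r.correct →
    r.HasSigned δ hash k l sig.msg

theorem GenuineSignatures.mono {s : LocalState n t V Hash}
    (hs : r.GenuineSignatures δ hash k s) (hk : k ≤ k') : r.GenuineSignatures δ hash k' s where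
  acks_msg := hs.acks_msg
  acks_signed p hp h := (hs.acks_signed p hp h).mono hk
  acks_card := hs.acks_card
  formed_valid := hs.formed_valid
  formed_signed sig h l hl hc := (hs.formed_signed sig h l hl hc).mono hk
  acquired_valid := hs.acquired_valid
  acquired_signed h sig ha l hl hc := (hs.acquired_signed h sig ha l hl hc).mono hk

theorem GenuineSignatures.insert_msg {s : LocalState n t V Hash} {h : Hash} {sig : PSig n Hash}
    [DecidableEq (PSig n Hash)]
    (hs : r.GenuineSignatures δ hash k s) (ho : s.ownHash = some h) (hv : sig.Valid j h) :
    ∀ p ∈ insert sig s.acks, p.msg = h := by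
  intro p hp
  rcases Finset.mem_insert.mp hp with rfl | hp
  · exact hv.2
  · exact Option.some.inj ((hs.acks_msg p hp).symm.trans ho)

theorem GenuineSignatures.insert_signed {s : LocalState n t V Hash} {h : Hash} {sig : PSig n Hash}
    [DecidableEq (PSig n Hash)]
    (hs : r.GenuineSignatures δ hash k s) (hf : r.Forgeable δ hash k (.stored h sig)) :
    ∀ p ∈ insert sig s.acks, p.signer ∈ r.correct → r.HasSigned δ hash k p.signer p.msg := by
  intro p hp
  rcases Finset.mem_insert.mp hp with rfl | hp
  · exact hf
  · exact hs.acks_signed p hp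

theorem combine_signed {h : Hash} {sigs : Finset (PSig n Hash)}
    (hs : ∀ p ∈ sigs, p.signer ∈ r.correct → r.HasSigned δ hash k p.signer p.msg) :
    ∀ l ∈ (combine h sigs).signers, l ∈ r.correct → r.HasSigned δ hash k l h :=
  fun _ hl => hs _ (exists_of_mem_signers_combine hl)

/-- Genuineness of signatures is preserved by a step that reacts to a genuine message. -/
theorem genuineSignatures_succ (hr : r.IsExecution δ hash) (inp : Input n t V Hash)
    (he : r.event k = some (i, inp))
    (hin : ∀ j m, inp = .receive j m → r.Forgeable δ hash k m)
    (hs : r.GenuineSignatures δ hash k (r.state δ hash k i)) :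
    r.GenuineSignatures δ hash (k + 1) (r.state δ hash (k + 1) i) ∧
      ∀ j m, r.Sends δ hash k i j m → r.Forgeable δ hash (k + 1) m := by
  classical
  have hk : k ≤ k + 1 := k.le_succ
  have hsent : ∀ p ∈ r.outbox δ hash k, r.Sends δ hash k i p.1 p.2 := fun p hp => ⟨⟨inp, he⟩, hp⟩
  have ht := transition (δ := δ) (hash := hash) he
  suffices r.GenuineSignatures δ hash (k + 1) (r.state δ hash (k + 1) i) ∧
      ∀ p ∈ r.outbox δ hash k, r.Forgeable δ hash (k + 1) p.2 from
    ⟨this.1, fun j m hm => this.2 (j, m) hm.2⟩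
  generalize r.outbox δ hash k = out at *
  generalize r.state δ hash (k + 1) i = s' at *
  have hm := hs.mono hk
  cases ht with
  | idle => exact ⟨hm, by simp⟩
  | start v l hl ha =>
    -- The start overwrites `ownHash`. Its old value was `none`, so there were neither
    -- acknowledgements nor a combined signature to contradict the new one.
    have hn : (r.state δ hash k i).ownHash = none := (hr.not_started he le_rfl).2
    refine ⟨{ hm with acks_msg := ?_, formed_valid := ?_ }, by simp [Forgeable]⟩
    · intro p hp
      have := hs.acks_msg p hp
      simp_all
    · intro sig hsig
      have := (hs.formed_valid sig hsig).1
      simp_all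
  | wake b l hl ha hb hd => exact ⟨{ hm with }, by simp [Forgeable]⟩
  | store l v ha hl =>
    refine ⟨{ hm with }, fun p hp => ?_⟩
    have := hsent p hp
    simp only [List.mem_singleton] at hp
    subst hp
    -- The signature in the message is produced by this very event, which counts as past at `k + 1`.
    exact fun _ => ⟨k, Nat.lt_succ_self k, l, this⟩
  | ack l h sig ha ho hv hf hc =>
    refine ⟨{ hm with acks_msg := ?_, acks_signed := ?_, acks_card := fun _ => hc }, by simp⟩
    · intro p hp
      rw [← hs.insert_msg ho hv p hp] at ho
      exact ho
    · exact fun p hp h => (hs.insert_signed (hin _ _ rfl) p hp h).mono hk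
  | form l h sig ha ho hv hf hc =>
    have hc' := combine_signed (h := h) (hs.insert_signed (hin _ _ rfl))
    refine ⟨{ hm with
      acks_msg := ?_, acks_signed := ?_, acks_card := ?_,
      formed_valid := ?_, formed_signed := ?_ }, ?_⟩
    · intro p hp
      rw [← hs.insert_msg ho hv p hp] at ho
      exact ho
    · exact fun p hp h => (hs.insert_signed (hin _ _ rfl) p hp h).mono hk
    · simp
    · rintro _ ⟨⟩
      exact ⟨ho, rfl, by rwa [card_signers_combine (hs.insert_msg ho hv)]⟩
    · rintro _ ⟨⟩ l hl hl'
      exact (hc' l hl hl').mono hk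
    · rintro ⟨j, m⟩ hp
      obtain rfl := mem_broadcast.mp hp
      exact fun l hl hl' => (hc' l hl hl').mono hk
  | acquire l h sig ha hv =>
    refine ⟨{ hm with acquired_valid := ?_, acquired_signed := ?_ }, ?_⟩
    · rintro _ _ ⟨⟩
      exact hv
    · rintro _ _ ⟨⟩
      exact ((hin _ _ rfl).mono hk)
    · rintro ⟨j, m⟩ hp
      obtain rfl := mem_broadcast.mp hp
      exact ((hin _ _ rfl).mono hk)

/-- States and sent messages have to be treated in one induction: a message from a correct process
was sent earlier and is covered by the induction hypothesis, one from a faulty process by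
`unforgeable`. -/
theorem IsExecution.genuineSignatures (ht0 : 0 < n - t) (hr : r.IsExecution δ hash) (k : ℕ)
    (i : Fin n) : r.GenuineSignatures δ hash k (r.state δ hash k i) := by
  suffices (∀ i, r.GenuineSignatures δ hash k (r.state δ hash k i)) ∧
      ∀ k' < k, ∀ i j m, r.Sends δ hash k' i j m → r.Forgeable δ hash k m from this.1 i
  induction k with
  | zero =>
    exact ⟨fun i => ⟨by simp [state, LocalState.initial], by simp [state, LocalState.initial],
      -- An empty set of acknowledgements is below the threshold only because `0 < n - t`.
      by simpa [state, LocalState.initial] using ht0, by simp [state, LocalState.initial],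
      by simp [state, LocalState.initial], by simp [state, LocalState.initial],
      by simp [state, LocalState.initial]⟩, by simp⟩
  | succ k ih =>
    have hin : ∀ i j m, r.event k = some (i, .receive j m) → r.Forgeable δ hash k m := by
      intro i j m he
      by_cases hj : j ∈ r.correct
      · obtain ⟨k', hk', hs⟩ := hr.authentic _ _ _ _ he hj
        exact ih.2 k' hk' _ _ _ hs
      · exact hr.unforgeable _ _ _ _ he hj
    refine ⟨fun i => ?_, fun k' hk' i j m hm => ?_⟩
    · by_cases he : ∃ inp, r.event k = some (i, inp)
      · obtain ⟨inp, he⟩ := he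
        exact (genuineSignatures_succ hr inp he (fun j m h => hin i j m (h ▸ he)) (ih.1 i)).1
      · rw [state_succ_of_ne (not_exists.mp he)]
        exact (ih.1 i).mono k.le_succ
    · rcases (Nat.lt_succ_iff_lt_or_eq.mp hk') with hk' | rfl
      · exact (ih.2 k' hk' i j m hm).mono k.le_succ
      · obtain ⟨inp, he⟩ := hm.1
        exact (genuineSignatures_succ hr inp he (fun j m h => hin i j m (h ▸ he))
          (ih.1 i)).2 j m hm

theorem IsExecution.integrity (ht0 : 0 < n - t) (hr : r.IsExecution δ hash) :
    r.Integrity δ hash :=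
  fun k i _ => (hr.genuineSignatures ht0 k i).acquired_valid

/-! ### Cached vectors -/

theorem vectors_spec (k : ℕ) {h : Hash} {v : Vec n t V}
    (hv : (r.state δ hash k i).vectors h = some v) : hash v = h ∧ r.Occurs v := by
  classical
  revert h v
  refine state_induction (P := fun _ s => ∀ {h v}, s.vectors h = some v →
    hash v = h ∧ r.Occurs v) i (by simp [LocalState.initial])
    (fun _ _ h => h) (fun l inp s' out he ih _ ht h v hv => ?_) k
  cases ht with
  | store m w ha hm =>
    by_cases hh : h = hash w
    · subst hh
      simp only [Function.update_self, Option.some.injEq] at hv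
      subst hv
      exact ⟨rfl, l, i, .inr ⟨m, he⟩⟩
    · simp only [Function.update_of_ne hh] at hv
      exact ih hv
  | _ => exact ih hv

/-- A cache entry can only be overwritten by a vector with the same hash, which is the same vector
by collision resistance. -/
theorem IsExecution.vectors_mono (hr : r.IsExecution δ hash) (hk : k ≤ k') {h : Hash}
    {v : Vec n t V} (hv : (r.state δ hash k i).vectors h = some v) :
    (r.state δ hash k' i).vectors h = some v := by
  classical
  obtain ⟨rfl, ho⟩ := vectors_spec k hv
  refine state_induction_from (P := fun _ s => s.vectors (hash v) = some v) i k hv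
    (fun _ _ _ h => h) (fun l inp s' out hl he ih _ ht => ?_) k' hk
  cases ht with
  | store m w ha hm =>
    by_cases hh : hash v = hash w
    · obtain rfl := hr.collision_free _ _ ho ⟨l, i, .inr ⟨m, he⟩⟩ hh
      simp
    · simpa [Function.update_of_ne hh] using ih
  | _ => exact ih

/-- Only `store` emits a signature, and it caches the signed vector in the same step. -/
theorem IsExecution.vectors_of_hasSigned (hr : r.IsExecution δ hash) {h : Hash}
    (hs : r.HasSigned δ hash k i h) :
    ∃ v, hash v = h ∧ r.Occurs v ∧ (r.state δ hash k i).vectors h = some v := by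
  obtain ⟨k', hk', j, ⟨inp, he⟩, hm⟩ := hs
  suffices ∃ v, (r.state δ hash (k' + 1) i).vectors h = some v by
    obtain ⟨v, hv⟩ := this
    exact ⟨v, (vectors_spec _ hv).1, (vectors_spec _ hv).2, hr.vectors_mono hk' hv⟩
  have ht := transition (δ := δ) (hash := hash) he
  generalize r.outbox δ hash k' = out at hm ht
  generalize r.state δ hash (k' + 1) i = s' at ht
  cases ht with
  | store l v ha hl =>
    simp only [List.mem_singleton, Prod.mk.injEq, Msg.stored.injEq] at hm
    exact ⟨v, by simp [hm.2.1]⟩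
  | _ => simp [mem_broadcast] at hm

theorem IsExecution.redundancy (ht0 : 0 < t) (hn : 3 * t < n) (hr : r.IsExecution δ hash) :
    r.Redundancy δ hash := by
  classical
  intro k i hi h sig hc
  have hg := hr.genuineSignatures (by omega) k i
  obtain ⟨⟨rfl, hcard⟩, hsig⟩ : sig.Valid t h ∧
      ∀ l ∈ sig.signers, l ∈ r.correct → r.HasSigned δ hash k l sig.msg := by
    rcases hc with ⟨ho, hf⟩ | ha
    · have := hg.formed_valid _ hf
      obtain rfl : h = sig.msg := Option.some.inj (ho.symm.trans this.1)
      exact ⟨this.2, hg.formed_signed _ hf⟩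
    · exact ⟨hg.acquired_valid _ _ ha, hg.acquired_signed _ _ ha⟩
  -- Of at least n - t signers at most t are faulty, and n - 2t ≥ t + 1.
  have hle : t + 1 ≤ (sig.signers ∩ r.correct).card := by
    have h1 := Finset.card_le_card (show sig.signers ⊆ (sig.signers ∩ r.correct) ∪ r.correctᶜ by
      intro l hl
      by_cases h : l ∈ r.correct <;> simp [hl, h])
    have h2 := Finset.card_union_le (sig.signers ∩ r.correct) r.correctᶜ
    have h3 := hr.faulty_le
    omega
  -- One correct signer fixes the vector; collision resistance then identifies those of all the
  -- others with it.
  obtain ⟨l, hl⟩ := Finset.card_pos.mp (t.succ_pos.trans_le hle)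
  rw [Finset.mem_inter] at hl
  obtain ⟨v, hv, hvo, -⟩ := hr.vectors_of_hasSigned (hsig l hl.1 hl.2)
  refine ⟨v, hv, hle.trans (Finset.card_le_card fun m hm => ?_)⟩
  rw [Finset.mem_inter] at hm
  obtain ⟨w, hw, hwo, hm'⟩ := hr.vectors_of_hasSigned (hsig m hm.1 hm.2)
  obtain rfl := hr.collision_free _ _ hvo hwo (hv.trans hw.symm)
  simp [hm.2, hm']

end Run

namespace Run

variable {r : Run n t V Hash} {δ : ℝ} {hash : Vec n t V → Hash} {k k' : ℕ} {i j : Fin n}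

/-! ### From times of events to their order. -/

theorem IsExecution.lt_of_time_lt (hr : r.IsExecution δ hash) (h : r.time k < r.time k') :
    k < k' := by
  by_contra hk
  exact (hr.time_mono (not_lt.mp hk)).not_gt h

/-- There is a first event after time `u`. -/
theorem IsExecution.exists_first_after (hr : r.IsExecution δ hash) (u : ℝ) :
    ∃ K, u < r.time K ∧ ∀ k < K, r.time k ≤ u := by
  classical
  have h : ∃ K, u < r.time K := (hr.time_unbounded.eventually_gt_atTop u).exists
  exact ⟨Nat.find h, Nat.find_spec h, fun k hk => not_lt.mp (Nat.find_min h hk)⟩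

/-! ### Spreading of threshold signatures -/

/-- Acquisition and rebroadcast are one step. Hence one acquisition spreads to all; conversely, as
long as no confirmation has been sent, nobody has stopped. -/
theorem sends_of_acquired (k : ℕ) (ha : (r.state δ hash k i).acquired ≠ none) :
    ∃ k' < k, ∃ h sig, TSig.Valid t sig h ∧ ∀ j, r.Sends δ hash k' i j (.confirm h sig) := by
  revert ha
  refine state_induction (P := fun k s => s.acquired ≠ none →
    ∃ k' < k, ∃ h sig, TSig.Valid t sig h ∧ ∀ j, r.Sends δ hash k' i j (.confirm h sig)) i
    (by simp [LocalState.initial]) (fun k s h ha => ?_) (fun l inp s' out he ih ho ht ha => ?_) k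
  · obtain ⟨k', hk', h'⟩ := h ha
    exact ⟨k', hk'.trans k.lt_succ_self, h'⟩
  · by_cases ha' : (r.state δ hash l i).acquired = none
    · cases ht with
      | acquire j h sig _ hv =>
        exact ⟨l, l.lt_succ_self, h, sig, hv, fun m => ⟨⟨_, he⟩, ho ▸ mem_broadcast.mpr rfl⟩⟩
      | _ => contradiction
    · obtain ⟨k', hk', h'⟩ := ih ha'
      exact ⟨k', hk'.trans l.lt_succ_self, h'⟩

theorem IsExecution.sends_of_formed (ht0 : 0 < n - t) (hr : r.IsExecution δ hash) (k : ℕ)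
    (hf : (r.state δ hash k i).formed ≠ none) :
    ∃ k' < k, ∃ h sig, TSig.Valid t sig h ∧ ∀ j, r.Sends δ hash k' i j (.confirm h sig) := by
  classical
  revert hf
  refine state_induction (P := fun k s => s.formed ≠ none →
    ∃ k' < k, ∃ h sig, TSig.Valid t sig h ∧ ∀ j, r.Sends δ hash k' i j (.confirm h sig)) i
    (by simp [LocalState.initial]) (fun k s h ha => ?_) (fun l inp s' out he ih ho ht hf => ?_) k
  · obtain ⟨k', hk', h'⟩ := h ha
    exact ⟨k', hk'.trans k.lt_succ_self, h'⟩
  · by_cases hf' : (r.state δ hash l i).formed = none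
    · have hg := hr.genuineSignatures ht0 l i
      cases ht with
      | form j h sig _ hown hv _ hc =>
        exact ⟨l, l.lt_succ_self, h, _,
          ⟨rfl, by rwa [card_signers_combine (hg.insert_msg hown hv)]⟩,
          fun m => ⟨⟨_, he⟩, ho ▸ mem_broadcast.mpr rfl⟩⟩
      | _ => contradiction
    · obtain ⟨k', hk', h'⟩ := ih hf'
      exact ⟨k', hk'.trans l.lt_succ_self, h'⟩

theorem acquired_of_receive {h : Hash} {sig : TSig n Hash} (hv : sig.Valid t h)
    (he : r.event k = some (i, .receive j (.confirm h sig))) :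
    (r.state δ hash (k + 1) i).acquired ≠ none := by
  rw [state_succ_of_event he]
  unfold step
  split_ifs with ha
  · exact ha
  · simp [onConfirm, hv]

theorem IsExecution.acquired_of_sends (hr : r.IsExecution δ hash) {h : Hash} {sig : TSig n Hash}
    (hv : sig.Valid t h) (hs : r.Sends δ hash k i j (.confirm h sig)) (hj : j ∈ r.correct)
    (hk' : max r.GST (r.time k) + δ < r.time k') : (r.state δ hash k' j).acquired ≠ none := by
  obtain ⟨l, -, he, hl⟩ := hr.delivery _ _ _ _ hs hj
  exact acquired_mono (hr.lt_of_time_lt (hl.trans_lt hk')) (acquired_of_receive hv he)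

/-! ### Progress of a slow broadcast -/

/-- As long as a slow broadcast goes on, its `m`-th message is sent in time. -/
theorem IsExecution.sends_slow (hr : r.IsExecution δ hash) (hδ : 0 < δ) (hj : j ∈ r.correct)
    {v : Vec n t V} (hs : r.Starts δ hash k j v) {B E : ℝ} (hB : r.GST ≤ B) (hkB : r.time k ≤ B)
    (hE : ∀ l, r.time l ≤ E → (r.state δ hash (l + 1) j).acquired = none) (m : Fin n)
    (hm : B + m * (δ * (n : ℝ) ^ (j : ℕ)) ≤ E) :
    ∃ l, k ≤ l ∧ r.time l ≤ B + m * (δ * (n : ℝ) ^ (j : ℕ)) ∧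
      r.Sends δ hash l j m (.slow v) ∧
      (r.state δ hash (l + 1) j).slow =
        some ⟨v, m + 1, r.clock j (r.time l) + δ * (n : ℝ) ^ (j : ℕ)⟩ := by
  have hD : 0 < δ * (n : ℝ) ^ (j : ℕ) :=
    mul_pos hδ (pow_pos (Nat.cast_pos.mpr j.pos) _)
  set D := δ * (n : ℝ) ^ (j : ℕ) with hDdef
  obtain ⟨m, hmn⟩ := m
  induction m with
  | zero =>
    refine ⟨k, le_rfl, by simpa using hkB, ⟨⟨_, hs.1⟩, ?_⟩, ?_⟩
    · rw [outbox_of_event hs.1]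
      simp [step, hs.2, onDisseminate, slowSend, j.pos]
    · rw [state_succ_of_event hs.1]
      simp [step, hs.2, onDisseminate, slowSend, j.pos, hDdef]
  | succ m ih =>
    simp only [Nat.cast_add, Nat.cast_one] at hm ih ⊢
    obtain ⟨l, hkl, hlt, hls, hl⟩ := ih (by omega) (by nlinarith)
    -- If the next message is not sent in time, the broadcast stays in state `b` up to the first
    -- event `K` after the bound, and `prompt` is violated there.
    by_contra hcon
    set b : SlowBroadcast n t V := ⟨v, m + 1, r.clock j (r.time l) + D⟩ with hb
    obtain ⟨K, hK, hK'⟩ := hr.exists_first_after (B + (m + 1) * D)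
    have hlK : l < K := hr.lt_of_time_lt (hlt.trans_lt (lt_trans (by nlinarith) hK))
    have hslow : ∀ k', l + 1 ≤ k' → k' ≤ K → (r.state δ hash k' j).slow = some b := by
      refine state_induction_from (P := fun k' s => k' ≤ K → s.slow = some b) j (l + 1)
        (fun _ => hl) (fun k' s _ h hk' => h (by omega)) (fun k' inp s' out hk' he ih ho ht hle => ?_)
      have ih := ih (by omega)
      cases ht with
      | start w _ _ _ =>
        have := hr.disseminate_once _ _ _ _ _ he hs.1
        omega
      -- A wake-up before `K` would send exactly the missing message in time.
      | wake b' p hp ha hb' hd =>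
        obtain rfl : b = b' := Option.some.inj (ih.symm.trans hb')
        refine absurd ⟨k', by omega, hK' k' (by omega), ⟨⟨_, he⟩, ?_⟩, ?_⟩ hcon
        · rw [ho]
          have : (⟨m + 1, hmn⟩ : Fin n) = p := Fin.ext hp.symm
          simp [this, hb]
        · rw [state_succ_of_event he]
          have hd' : r.clock j (r.time l) + D ≤ r.clock j (r.time k') := hd
          rw [hDdef] at hd'
          simp [step, ha, onWake, ih, hb, hd', slowSend, hmn, hDdef]
      | _ => exact ih
    have hacq : (r.state δ hash K j).acquired = none := by
      obtain ⟨K, rfl⟩ : ∃ K', K = K' + 1 := ⟨K - 1, by omega⟩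
      exact hE K ((hK' K (Nat.lt_succ_self K)).trans hm)
    have hp := hr.prompt K j hj b.deadline ⟨hacq, b, hslow K hlK le_rfl, hmn, rfl⟩
      (max r.GST (r.time l) + D) (lt_of_le_of_lt ?_ hK)
    · have h1 := hr.clock_rate j (max r.GST (r.time l)) (max r.GST (r.time l) + D)
        (le_max_left _ _) (by linarith)
      have h2 := hr.clock_mono j (le_max_right r.GST (r.time l))
      simp only [hb] at hp
      linarith
    · have : max r.GST (r.time l) ≤ B + m * D :=
        max_le (hB.trans (by simp only [le_add_iff_nonneg_right]; positivity)) hlt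
      linarith

/-! ### Acknowledgements -/

theorem exists_of_mem_disseminated (k : ℕ) (hj : j ∈ (r.state δ hash k i).disseminated) :
    ∃ k' < k, ∃ v, r.event k' = some (i, .receive j (.slow v)) ∧
      r.Sends δ hash k' i j (.stored (hash v) ⟨i, hash v⟩) := by
  classical
  revert hj
  refine state_induction (P := fun k s => j ∈ s.disseminated →
    ∃ k' < k, ∃ v, r.event k' = some (i, .receive j (.slow v)) ∧
      r.Sends δ hash k' i j (.stored (hash v) ⟨i, hash v⟩)) i
    (by simp [LocalState.initial]) (fun k s h ha => ?_) (fun l inp s' out he ih ho ht hj => ?_) k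
  · obtain ⟨k', hk', h'⟩ := h ha
    exact ⟨k', hk'.trans k.lt_succ_self, h'⟩
  · by_cases hj' : j ∈ (r.state δ hash l i).disseminated
    · obtain ⟨k', hk', h'⟩ := ih hj'
      exact ⟨k', hk'.trans l.lt_succ_self, h'⟩
    · cases ht with
      | store m v ha hm =>
        obtain rfl : j = m := by
          rcases Finset.mem_insert.mp hj with h | h
          · exact h
          · contradiction
        exact ⟨l, l.lt_succ_self, v, he, ⟨_, he⟩, by simp [ho]⟩
      | _ => contradiction

/-- A correct `j` disseminates a single vector, so even if this is a repeated reception, the earlier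
acknowledgement was for the same hash. -/
theorem IsExecution.sends_stored (hr : r.IsExecution δ hash) (hj : j ∈ r.correct)
    {v : Vec n t V} (hs : r.Starts δ hash k j v)
    (he : r.event k' = some (i, .receive j (.slow v)))
    (ha : (r.state δ hash k' i).acquired = none) :
    ∃ l ≤ k', k < l ∧ r.Sends δ hash l i j (.stored (hash v) ⟨i, hash v⟩) := by
  have key : ∀ {l w}, r.event l = some (i, .receive j (.slow w)) → k < l ∧ w = v := by
    intro l w hl
    obtain ⟨p, hp, hps⟩ := hr.authentic _ _ _ _ hl hj
    obtain ⟨q, hq, hqs⟩ := starts_of_sends_slow hps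
    obtain ⟨rfl, rfl⟩ := hr.starts_unique hqs hs
    exact ⟨hq.trans_lt hp, rfl⟩
  by_cases hd : j ∈ (r.state δ hash k' i).disseminated
  · obtain ⟨l, hl, w, hle, hls⟩ := exists_of_mem_disseminated k' hd
    obtain ⟨hkl, rfl⟩ := key hle
    exact ⟨l, hl.le, hkl, hls⟩
  · refine ⟨k', le_rfl, (key he).1, ⟨_, he⟩, ?_⟩
    rw [outbox_of_event he]
    simp [step, ha, onSlow, hd]

/-- A genuine acknowledgement of the own hash is dropped only if a threshold signature has already
been combined. -/
theorem IsExecution.formed_or_mem_acks (hr : r.IsExecution δ hash) {v : Vec n t V}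
    (hs : r.Starts δ hash k j v) (hk : k < k')
    (he : r.event k' = some (j, .receive i (.stored (hash v) ⟨i, hash v⟩)))
    (ha : (r.state δ hash k' j).acquired = none) :
    (r.state δ hash (k' + 1) j).formed ≠ none ∨
      ⟨i, hash v⟩ ∈ (r.state δ hash (k' + 1) j).acks := by
  rw [state_succ_of_event he]
  have ho := hr.ownHash_of_starts hs hk
  have hv : PSig.Valid (⟨i, hash v⟩ : PSig n Hash) i (hash v) := ⟨rfl, rfl⟩
  by_cases hf : (r.state δ hash k' j).formed = none
  · simp only [step, ha, onStored, ho, hv, hf]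
    simp only [ne_eq, not_true_eq_false, if_false, and_self, if_true]
    split_ifs <;> simp
  · left
    simp [step, ha, onStored, hf]

/-- The main estimate: a dissemination makes all correct processes acquire a pair in time. -/
theorem IsExecution.acquired_of_starts (ht0 : 0 < n - t) (hr : r.IsExecution δ hash) (hδ : 0 < δ)
    (hj : j ∈ r.correct) {v : Vec n t V} (hs : r.Starts δ hash k j v) {B : ℝ} (hB : r.GST ≤ B)
    (hkB : r.time k ≤ B) (hi : i ∈ r.correct)
    (hk' : B + (n - 1) * (δ * (n : ℝ) ^ (j : ℕ)) + 3 * δ < r.time k') :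
    (r.state δ hash k' i).acquired ≠ none := by
  intro hcon
  set D := δ * (n : ℝ) ^ (j : ℕ) with hD
  have hn : (1 : ℝ) ≤ n := by exact_mod_cast j.pos
  have hDpos : 0 < D := mul_pos hδ (by positivity)
  have hnD : 0 ≤ (n - 1 : ℝ) * D := mul_nonneg (by linarith) hDpos.le
  -- no confirmation is sent so early that `i` would have acquired it
  have hquiet : ∀ {l p h sig}, TSig.Valid t sig h → r.time l ≤ B + (n - 1) * D + 2 * δ →
      ¬ r.Sends δ hash l p i (.confirm h sig) := fun hv hl hls =>
    hr.acquired_of_sends hv hls hi (lt_of_le_of_lt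
      (by linarith [max_le (show r.GST ≤ B + (n - 1) * D + 2 * δ by linarith) hl]) hk') hcon
  -- Any acquisition comes with a confirmation to `i`, so up to this time nobody has stopped.
  have hacq : ∀ p l, r.time l ≤ B + (n - 1) * D + 2 * δ →
      (r.state δ hash (l + 1) p).acquired = none := by
    intro p l hl
    by_contra ha
    obtain ⟨q, hq, h, sig, hv, hqs⟩ := sends_of_acquired _ ha
    exact hquiet hv ((hr.time_mono (Nat.lt_succ_iff.mp hq)).trans hl) (hqs i)
  obtain ⟨K, hK, hK'⟩ := hr.exists_first_after (B + (n - 1) * D + 2 * δ)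
  -- The vector is sent to `p` by B + (n - 1) D, arrives δ later, and its acknowledgement is back
  -- after another δ.
  have hack : ∀ p ∈ r.correct, (r.state δ hash K j).formed ≠ none ∨
      ⟨p, hash v⟩ ∈ (r.state δ hash K j).acks := by
    intro p hp
    have hpn : ((p : ℕ) : ℝ) ≤ n - 1 := by
      have : ((p : ℕ) : ℝ) + 1 ≤ n := by exact_mod_cast p.isLt
      linarith
    have hpD : (p : ℕ) * D ≤ (n - 1) * D := mul_le_mul_of_nonneg_right hpn hDpos.le
    obtain ⟨l₁, -, hl₁, hls₁, -⟩ := hr.sends_slow hδ hj hs hB hkB (hacq j) p (by linarith)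
    have hmax : ∀ {x y : ℝ}, x ≤ B + (n - 1) * D + y → 0 ≤ y →
        max r.GST x ≤ B + (n - 1) * D + y := fun h hy => max_le (by linarith) h
    obtain ⟨l₂, -, hle₂, hl₂⟩ := hr.delivery _ _ _ _ hls₁ hp
    have hl₂' : r.time l₂ ≤ B + (n - 1) * D + δ := by
      linarith [hmax (x := r.time l₁) (y := 0) (by linarith) le_rfl]
    obtain ⟨l₃, hl₃, hkl₃, hls₃⟩ := hr.sends_stored hj hs hle₂
      (acquired_eq_none_of_le l₂.le_succ (hacq p l₂ (by linarith)))
    obtain ⟨l₄, hl₃₄, hle₄, hl₄⟩ := hr.delivery _ _ _ _ hls₃ hj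
    have hl₄' : r.time l₄ ≤ B + (n - 1) * D + 2 * δ := by
      linarith [hmax ((hr.time_mono hl₃).trans hl₂') hδ.le]
    have hl₄K : l₄ + 1 ≤ K := hr.lt_of_time_lt (hl₄'.trans_lt hK)
    exact (hr.formed_or_mem_acks hs (hkl₃.trans hl₃₄) hle₄
      (acquired_eq_none_of_le l₄.le_succ (hacq j l₄ hl₄'))).imp
      (formed_mono hl₄K) (fun h => acks_mono hl₄K h)
  -- The at least n - t correct processes give distinct signatures, too many for `acks_card` if none
  -- were combined.
  have hformed : (r.state δ hash K j).formed ≠ none := by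
    classical
    intro hf
    have hlt := (hr.genuineSignatures ht0 K j).acks_card hf
    have hle : (r.correct.image fun p => (⟨p, hash v⟩ : PSig n Hash)).card ≤
        (r.state δ hash K j).acks.card := by
      refine Finset.card_le_card fun x hx => ?_
      obtain ⟨p, hp, rfl⟩ := Finset.mem_image.mp hx
      exact (hack p hp).resolve_left (not_not.mpr hf)
    rw [Finset.card_image_of_injective _ (fun a b h => congrArg PSig.signer h)] at hle
    have h1 := hr.faulty_le
    have h2 := Finset.card_add_card_compl r.correct
    rw [Fintype.card_fin] at h2
    omega
  obtain ⟨q, hq, h, sig, hv, hqs⟩ := hr.sends_of_formed ht0 K hformed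
  exact hquiet hv (hK' q hq) (hqs i)

theorem IsExecution.termination (ht0 : 0 < n - t) (hr : r.IsExecution δ hash) (hδ : 0 < δ) :
    r.Termination δ hash := by
  rintro ⟨j, hj, k, v, he⟩ i hi
  suffices ∃ k', (r.state δ hash k' i).acquired ≠ none by
    obtain ⟨k', h⟩ := this
    obtain ⟨⟨h, sig⟩, hp⟩ := Option.ne_none_iff_exists'.mp h
    exact ⟨k', h, sig, hp⟩
  by_cases ha : (r.state δ hash k j).acquired = none
  · obtain ⟨K, hK, -⟩ := hr.exists_first_after
      (max r.GST (r.time k) + (n - 1) * (δ * (n : ℝ) ^ (j : ℕ)) + 3 * δ)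
    exact ⟨K, hr.acquired_of_starts ht0 hδ hj ⟨he, ha⟩ (le_max_left _ _) (le_max_right _ _) hi hK⟩
  -- The request came after `j` had stopped; the rebroadcast made by `j` on stopping reaches
  -- everyone.
  · obtain ⟨q, -, h, sig, hv, hs⟩ := sends_of_acquired _ ha
    obtain ⟨K, hK, -⟩ := hr.exists_first_after (max r.GST (r.time q) + δ)
    exact ⟨K, hr.acquired_of_sends hv (hs i) hi hK⟩

end Run

/-! ### Counting words. -/

/-- A bound on the number of words that a process with local state `s` has sent, not counting its
slow broadcast. -/
def LocalState.potential (s : LocalState n t V Hash) : ℕ :=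
  2 * s.disseminated.card + (if s.formed = none then 0 else 2 * n) +
    (if s.acquired = none then 0 else 2 * n)

theorem LocalState.potential_le (s : LocalState n t V Hash) : s.potential ≤ 6 * n := by
  have h := s.disseminated.card_le_univ
  rw [Fintype.card_fin] at h
  unfold potential
  split_ifs <;> omega

theorem sum_words_broadcast_confirm (h : Hash) (sig : TSig n Hash) :
    ((broadcast (.confirm h sig : Msg n t V Hash)).map (fun p => p.2.words)).sum = 2 * n := by
  simp [broadcast, Msg.words, Function.comp_def, mul_comm]

namespace Run

variable {r : Run n t V Hash} {δ : ℝ} {hash : Vec n t V → Hash} {k k' : ℕ} {i j : Fin n}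

/-- The number of words sent at the `k`-th event. -/
noncomputable def wordsSent (r : Run n t V Hash) (δ : ℝ) (hash : Vec n t V → Hash) (k : ℕ) : ℕ :=
  ((r.outbox δ hash k).map (fun p => p.2.words)).sum

open scoped Classical in
/-- The number of words sent by process `i` at and after GST, and before the `K`-th event. -/
noncomputable def lateWords (r : Run n t V Hash) (δ : ℝ) (hash : Vec n t V → Hash) (K : ℕ)
    (i : Fin n) : ℕ :=
  ∑ k ∈ Finset.range K,
    if r.GST ≤ r.time k ∧ ∃ inp, r.event k = some (i, inp) then r.wordsSent δ hash k else 0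

open scoped Classical in
theorem sum_lateWords (r : Run n t V Hash) (δ : ℝ) (hash : Vec n t V → Hash) (K : ℕ) :
    ∑ k ∈ Finset.range K, (if r.GST ≤ r.time k then r.wordsSent δ hash k else 0) =
      ∑ i, r.lateWords δ hash K i := by
  unfold lateWords
  rw [Finset.sum_comm]
  refine Finset.sum_congr rfl fun k _ => ?_
  rcases he : r.event k with _ | ⟨l, inp⟩
  · simp [wordsSent, outbox, he]
  · rw [Finset.sum_eq_single l] <;> simp +contextual [eq_comm]

/-- Each process spends few words besides those of its slow broadcast, and its slow broadcast
proceeds slowly after GST. -/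
theorem IsExecution.exists_lateWords_le (hr : r.IsExecution δ hash) (hδ : 0 < δ) {E : ℝ}
    (hE : (∃ k v, r.Starts δ hash k i v) → ∀ k, (r.state δ hash k i).acquired = none →
      r.clock i (r.time k) ≤ E) (K : ℕ) :
    ∃ c : ℕ, r.lateWords δ hash K i ≤ (r.state δ hash K i).potential + (n - t) * c ∧
      (c = 0 ∨ ∃ b, (r.state δ hash K i).slow = some b ∧ c ≤ b.next ∧ b.next ≤ n ∧
        r.clock i r.GST + c * (δ * (n : ℝ) ^ (i : ℕ)) ≤ b.deadline ∧
        b.deadline ≤ E + δ * (n : ℝ) ^ (i : ℕ)) := by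
  classical
  have hD : 0 < δ * (n : ℝ) ^ (i : ℕ) :=
    mul_pos hδ (pow_pos (Nat.cast_pos.mpr i.pos) _)
  set D := δ * (n : ℝ) ^ (i : ℕ) with hDdef
  -- `c` bounds the slow messages sent at or after GST. Each pushes the deadline on by at least `D`,
  -- which gives the lower bound; the last one was sent while participating, at clock value at most
  -- `E`, which gives the upper bound.
  induction K with
  | zero => exact ⟨0, by simp [lateWords], .inl rfl⟩
  | succ K ih =>
    by_cases he : ∃ inp, r.event K = some (i, inp)
    swap
    · rw [state_succ_of_ne (not_exists.mp he)]
      simpa [lateWords, Finset.sum_range_succ, he] using ih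
    rcases lt_or_ge (r.time K) r.GST with hK | hK
    -- No word is counted before GST, so `c` stays 0 even if the slow broadcast is already running.
    · refine ⟨0, ?_, .inl rfl⟩
      have : r.lateWords δ hash (K + 1) i = 0 := Finset.sum_eq_zero fun k hk => if_neg fun h =>
        absurd (h.1.trans (hr.time_mono (Nat.lt_succ_iff.mp (Finset.mem_range.mp hk)))) hK.not_ge
      omega
    have hW : r.lateWords δ hash (K + 1) i = r.lateWords δ hash K i + r.wordsSent δ hash K := by
      simp [lateWords, Finset.sum_range_succ, he, hK]
    have hclock := hr.clock_mono i hK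
    rw [hW, wordsSent]
    obtain ⟨inp, he⟩ := he
    obtain ⟨c, hc, hc'⟩ := ih
    have ht := transition (δ := δ) (hash := hash) he
    have hEK := fun h => hE h K
    generalize r.outbox δ hash K = out at ht ⊢
    generalize r.state δ hash (K + 1) i = s' at ht ⊢
    cases ht with
    | idle => exact ⟨c, by simpa using hc, hc'⟩
    | start v l hl ha =>
      have hslow := (hr.not_started he le_rfl).1
      obtain rfl : c = 0 := by
        rcases hc' with h | ⟨b, hb, -⟩
        · exact h
        · simp [hslow] at hb
      refine ⟨1, ?_, .inr ⟨_, rfl, le_rfl, i.pos, ?_, ?_⟩⟩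
      · simp only [LocalState.potential, List.map_cons, List.map_nil, List.sum_singleton,
          Msg.words] at hc ⊢
        omega
      · simp only [Nat.cast_one]
        linarith
      · linarith [hEK ⟨K, v, he, ha⟩ ha]
    | wake b l hl ha hb hd =>
      have hlt := l.isLt
      refine ⟨c + 1, ?_, .inr ⟨_, rfl, ?_, ?_, ?_, ?_⟩⟩
      · simp only [LocalState.potential, List.map_cons, List.map_nil, List.sum_singleton,
          Msg.words, mul_add] at hc ⊢
        omega
      · rcases hc' with rfl | ⟨b', hb', h, -⟩
        · simp
        · obtain rfl : b = b' := Option.some.inj (hb.symm.trans hb')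
          simpa using h
      · simp only
        omega
      · rcases hc' with rfl | ⟨b', hb', -, -, h, -⟩
        · simp only [zero_add, Nat.cast_one]
          linarith
        · obtain rfl : b = b' := Option.some.inj (hb.symm.trans hb')
          simp only [Nat.cast_add, Nat.cast_one]
          linarith
      · simp only
        obtain ⟨q, -, hq⟩ := starts_of_slow K hb
        linarith [hEK ⟨q, _, hq⟩ ha]
    | store l v ha hl =>
      refine ⟨c, ?_, hc'⟩
      simp only [LocalState.potential, Finset.card_insert_of_notMem hl, List.map_cons,
        List.map_nil, List.sum_singleton, Msg.words] at hc ⊢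
      omega
    | ack => exact ⟨c, by simpa [LocalState.potential] using hc, hc'⟩
    | form l h sig ha ho hv hf =>
      refine ⟨c, ?_, hc'⟩
      rw [sum_words_broadcast_confirm]
      simp only [LocalState.potential, hf, if_true, reduceCtorEq, if_false] at hc ⊢
      omega
    | acquire l h sig ha hv =>
      refine ⟨c, ?_, hc'⟩
      rw [sum_words_broadcast_confirm]
      simp only [LocalState.potential, ha, if_true, reduceCtorEq, if_false] at hc ⊢
      omega

/-- Take for `E` the clock value at `T`: after GST clocks measure real time. The count is `c - 1`
because the first late message need not be preceded by a full wait. -/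
theorem IsExecution.lateWords_le (hr : r.IsExecution δ hash) (hδ : 0 < δ) {T : ℝ} (hT : r.GST ≤ T)
    (hE : ∀ k, (r.state δ hash k i).acquired = none → r.time k ≤ T) (K : ℕ) :
    ∃ c : ℕ, r.lateWords δ hash K i ≤ 6 * n + n * c ∧ c ≤ n ∧
      (c - 1 : ℝ) * (δ * (n : ℝ) ^ (i : ℕ)) ≤ T - r.GST := by
  obtain ⟨c, hc, hc'⟩ := hr.exists_lateWords_le hδ (i := i) (E := r.clock i T)
    (fun _ k ha => hr.clock_mono i (hE k ha)) K
  have hD : 0 < δ * (n : ℝ) ^ (i : ℕ) :=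
    mul_pos hδ (pow_pos (Nat.cast_pos.mpr i.pos) _)
  refine ⟨c, hc.trans (add_le_add (LocalState.potential_le _)
    (Nat.mul_le_mul_right _ (Nat.sub_le _ _))), ?_⟩
  rcases hc' with rfl | ⟨b, -, h1, h2, h3, h4⟩
  · exact ⟨n.zero_le, by simp; linarith⟩
  · have := hr.clock_rate i r.GST T le_rfl hT
    exact ⟨h1.trans h2, by linarith⟩

/-- A process that never starts a dissemination sends few words. -/
theorem IsExecution.lateWords_le_of_not_starts (hr : r.IsExecution δ hash) (hδ : 0 < δ)
    (hi : ∀ k v, ¬ r.Starts δ hash k i v) (K : ℕ) : r.lateWords δ hash K i ≤ 6 * n := by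
  classical
  obtain ⟨c, hc, rfl | ⟨b, hb, -⟩⟩ := hr.exists_lateWords_le hδ (i := i)
    (E := 0) (fun ⟨k, v, h⟩ => absurd h (hi k v)) K
  · exact hc.trans (by simpa using LocalState.potential_le _)
  · obtain ⟨k, -, h⟩ := starts_of_slow K hb
    exact absurd h (hi _ _)

/-- The waiting times grow so fast with the index that a process sends only few messages of its slow
broadcast while a process of smaller index completes its own. -/
theorem count_le_three {c : ℕ} (hn : 4 ≤ n) (hδ : 0 < δ) (hji : j < i)
    (hc : (c - 1 : ℝ) * (δ * (n : ℝ) ^ (i : ℕ)) ≤ (n - 1) * (δ * (n : ℝ) ^ (j : ℕ)) + 4 * δ) :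
    c ≤ 3 := by
  have hn' : (4 : ℝ) ≤ n := by exact_mod_cast hn
  have h1 : (1 : ℝ) ≤ (n : ℝ) ^ (j : ℕ) := one_le_pow₀ (by linarith)
  have h2 : (n : ℝ) * (n : ℝ) ^ (j : ℕ) ≤ (n : ℝ) ^ (i : ℕ) := by
    rw [← pow_succ']
    exact pow_le_pow_right₀ (by linarith) hji
  have h3 : (c - 1 : ℝ) * (n : ℝ) ^ (i : ℕ) ≤ (n - 1) * (n : ℝ) ^ (j : ℕ) + 4 := by
    refine le_of_mul_le_mul_left ?_ hδ
    linarith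
  -- Four messages would give 3 n^i ≤ n^i - n^j + 4, which fails since n^i ≥ n ≥ 4.
  by_contra h
  have h4 : (4 : ℝ) ≤ c := by exact_mod_cast not_le.mp h
  have h5 : 3 * (n : ℝ) ^ (i : ℕ) ≤ (c - 1) * (n : ℝ) ^ (i : ℕ) :=
    mul_le_mul_of_nonneg_right (by linarith) (by positivity)
  have h6 : (n : ℝ) ≤ n * (n : ℝ) ^ (j : ℕ) := le_mul_of_one_le_right (by linarith) h1
  linarith

theorem IsExecution.sum_lateWords_le (ht0 : 0 < t) (hn : 3 * t < n) (hr : r.IsExecution δ hash)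
    (hδ : 0 < δ) (hl : r.NoLateStart δ hash) (K : ℕ) :
    ∑ i, r.lateWords δ hash K i ≤ 10 * n ^ 2 := by
  classical
  by_cases hst : ∃ j k v, r.Starts δ hash k j v
  · obtain ⟨j, ⟨k, v, hs⟩, hmin⟩ : ∃ j, (∃ k v, r.Starts δ hash k j v) ∧
        ∀ i < j, ¬ ∃ k v, r.Starts δ hash k i v :=
      let ⟨j, hj, h⟩ := WellFounded.has_min (wellFounded_lt (α := Fin n))
        {j | ∃ k v, r.Starts δ hash k j v} hst
      ⟨j, hj, fun i hi hi' => h i hi' hi⟩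
    have hj := hr.event_correct _ _ _ hs.1
    have hbound : ∀ i, r.lateWords δ hash K i ≤ 9 * n + if i = j then n * n else 0 := by
      intro i
      by_cases hi : ∃ k v, r.Starts δ hash k i v
      · obtain ⟨k', v', hs'⟩ := hi
        have hn1 : (1 : ℝ) ≤ n := by exact_mod_cast j.pos
        have hpos : 0 ≤ (n - 1 : ℝ) * (δ * (n : ℝ) ^ (j : ℕ)) :=
          mul_nonneg (by linarith) (by positivity)
        obtain ⟨c, hc, hcn, hc'⟩ := hr.lateWords_le hδ (i := i)
          -- The main estimate with B = GST + δ, the latest possible start of `j`.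
          (T := r.GST + δ + (n - 1) * (δ * (n : ℝ) ^ (j : ℕ)) + 3 * δ) (by linarith)
          (fun l ha => by
            by_contra hlt
            exact hr.acquired_of_starts (by omega) hδ hj hs (by linarith)
              (hl _ _ hj _ hs.1 hs.2) (hr.event_correct _ _ _ hs'.1) (not_le.mp hlt) ha) K
        split_ifs with hij
        · have := Nat.mul_le_mul_left n hcn
          omega
        · have hji : j < i := lt_of_le_of_ne
            (not_lt.mp fun h => hmin i h ⟨k', v', hs'⟩) (Ne.symm hij)
          -- Minimality of `j` gives `j < i`, so the slow broadcast of `i` adds at most 3n to the 6n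
          -- other words.
          have := Nat.mul_le_mul_left n (count_le_three (by omega) hδ hji (by linarith))
          omega
      · have := hr.lateWords_le_of_not_starts hδ (fun k v h => hi ⟨k, v, h⟩) K
        omega
    refine (Finset.sum_le_sum fun i _ => hbound i).trans ?_
    rw [Finset.sum_add_distrib]
    simp
    nlinarith
  · refine (Finset.sum_le_sum fun i _ => hr.lateWords_le_of_not_starts hδ
      (fun k v h => hst ⟨i, k, v, h⟩) K).trans ?_
    simp
    nlinarith

theorem IsExecution.commComplexity_le (ht0 : 0 < t) (hn : 3 * t < n) (hr : r.IsExecution δ hash)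
    (hδ : 0 < δ) (hl : r.NoLateStart δ hash) :
    r.commComplexity δ hash ≤ ((10 * n ^ 2 : ℕ) : ℝ≥0∞) := by
  classical
  refine ENNReal.tsum_le_of_sum_range_le fun K => ?_
  have h := hr.sum_lateWords_le ht0 hn hδ hl K
  rw [← sum_lateWords] at h
  refine le_trans (le_of_eq ?_) (Nat.cast_le.mpr h)
  push_cast [wordsSent]
  refine Finset.sum_congr rfl fun k _ => ?_
  split_ifs <;> simp

end Run

end VectorDissemination

theorem mainTheorem9 :
    ∃ C : ℕ, ∀ (n t : ℕ), 0 < t → 3 * t < n →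
      ∀ (V : Type*) (Hash : Type*) (hash : VectorDissemination.Vec n t V → Hash)
        (δ : ℝ), 0 < δ →
      ∀ r : VectorDissemination.Run n t V Hash, r.IsExecution δ hash →
        (r.NoLateStart δ hash → r.commComplexity δ hash ≤ (C : ℝ≥0∞) * (n : ℝ≥0∞) ^ 2) ∧
        r.Termination δ hash ∧ r.Integrity δ hash ∧ r.Redundancy δ hash := by
  refine ⟨10, fun n t ht hn V Hash hash δ hδ r hr => ⟨fun hl => ?_, ?_, ?_, ?_⟩⟩
  · exact_mod_cast hr.commComplexity_le ht hn hδ hl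
  · exact hr.termination (by omega) hδ
  · exact hr.integrity (by omega)
  · exact hr.redundancy ht hn
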